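/- **Setting.** A market has $n$ unit-demand buyers, $m$ sellers with one good each, values $v_{ij}\ge 0$, and a bipartite graph $G$ of direct buyer–seller links. For a network $g$, an allocation is feasible if every buyer gets at most one good, every good is sold at most once, and only links of $g$ are used; $W(g)$ is the maximum total value of a feasible allocation. A competitive equilibrium for $g$ consists of prices $p\ge 0$ and a feasible allocation such that every buyer has non-negative utility (value minus price), no buyer $i$ would get strictly higher utility from a good $j$ to which $i$ is linked in $g$, and unsold goods have price $0$. If the set $P$ of sellers joins the platform, the network becomes $G(P)$, in which sellers in $P$ are linked to all buyers and the other links are those of $G$; the price $p_j(P)$ of good $j$ is then its maximum competitive price for $G(P)$. At transaction fee $\alpha\in[0,1]$ seller $j$ obtains $u_j(P,\alpha)=(1-\alpha)p_j(P)$ if $j\in P$ and $u_j(P,\alpha)=p_j(P)$ otherwise, and the platform's revenue is $\alpha\sum_{j\in P}p_j(P)$. A pure platform equilibrium at fee $\alpha$ is a set $P$ from which no seller gains by a unilateral deviation (joining or leaving). A mixed platform equilibrium at fee $\alpha$ is a vector $x\in[0,1]^m$ of independent joining probabilities such that no seller can increase its expected utility by surely joining or surely staying off. An unregulated platform chooses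 the fee $\alpha\in[0,1]$, and an equilibrium at that fee, so as to maximize its (expected) revenue. The *mixed price of anarchy* of a market is the supremum of $W^\star/\mathbb E_{P\sim x}[W(G(P))]$ over all pairs $(\alpha,x)$ that maximize expected revenue among all fees in $[0,1]$ and all mixed equilibria at these fees, where $W^\star$ is the welfare for the complete bipartite graph. The *pure price of anarchy* is the supremum of $W^\star/W(G(P))$ over all pairs $(\alpha,P)$ that maximize revenue among all fees in $[0,1]$ and all pure equilibria at these fees. (Both are taken in $[0,\infty]$, with supremum $0$ over the empty set.) **Proposition.** For all integers $n,m\ge 1$ there is a sequence $(M_k)_{k\in\mathbb N}$ of markets with $n$ buyers and $m$ sellers such that both the pure and the mixed price of anarchy of $M_k$ converge to $\min\{n,m\}$ as $k\to\infty$. -/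

import Mathlib

open Filter Topology
open scoped ENNReal

noncomputable section

/-- A buyer-seller network with `n` unit-demand buyers and `m` single-item sellers:
`value i j` is the value of buyer `i` for the good of seller `j`, and `link i j` says that
buyer `i` can transact directly (off the platform) with seller `j`. -/
structure Market (n m : ℕ) where
  value : Fin n → Fin m → ℝ
  value_nonneg : ∀ i j, 0 ≤ value i j
  link : Fin n → Fin m → Prop

namespace Market

variable {n m : ℕ}

/-- The network `G(P)` once the sellers in `P` have joined the platform: a seller on the platform
can transact with every buyer, the links of the other sellers are unchanged. -/
def linkWith (M : Market n m) (P : Finset (Fin m)) (i : Fin n) (j : Fin m) : Prop :=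
  j ∈ P ∨ M.link i j

/-- An allocation assigns at most one good to every buyer. It is feasible for the network `g` if it
uses only links of `g` and sells no good twice. -/
def Feasible (g : Fin n → Fin m → Prop) (a : Fin n → Option (Fin m)) : Prop :=
  (∀ i j, a i = some j → g i j) ∧
    ∀ i i' j, a i = some j → a i' = some j → i = i'

/-- The value that buyer `i` gets from the good allocated to her, and `0` without a good. -/
def allocValue (M : Market n m) (a : Fin n → Option (Fin m)) (i : Fin n) : ℝ :=
  (a i).elim 0 fun j => M.value i j

/-- Quasi-linear utility of buyer `i` at prices `p` and allocation `a`. -/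
def buyerUtility (M : Market n m) (p : Fin m → ℝ) (a : Fin n → Option (Fin m)) (i : Fin n) : ℝ :=
  (a i).elim 0 fun j => M.value i j - p j

/-- `W(S, B, v, g)`: the largest total value of an allocation that is feasible for `g`
(a maximum over a finite, nonempty set). -/
def welfare (M : Market n m) (g : Fin n → Fin m → Prop) : ℝ :=
  sSup {w | ∃ a, Feasible g a ∧ w = ∑ i, M.allocValue a i}

/-- The welfare of the unconstrained market, in which each buyer can transact with each seller. -/
def optimalWelfare (M : Market n m) : ℝ :=
  M.welfare fun _ _ => True

/-- Competitive (Walrasian) equilibrium `(p, a)` for the network `g`. -/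
structure IsCompetitiveEquilibrium (M : Market n m) (g : Fin n → Fin m → Prop)
    (p : Fin m → ℝ) (a : Fin n → Option (Fin m)) : Prop where
  price_nonneg : ∀ j, 0 ≤ p j
  feasible : Feasible g a
  best : ∀ i j, g i j → M.value i j - p j ≤ M.buyerUtility p a i
  utility_nonneg : ∀ i, 0 ≤ M.buyerUtility p a i
  unsold : ∀ j, (∀ i, a i ≠ some j) → p j = 0

/-- Competitive prices: prices that are part of some competitive equilibrium. -/
def IsCompetitivePrice (M : Market n m) (g : Fin n → Fin m → Prop) (p : Fin m → ℝ) : Prop :=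
  ∃ a, M.IsCompetitiveEquilibrium g p a

/-- The maximum competitive price of good `j` once the sellers in `P` have joined. -/
def price (M : Market n m) (P : Finset (Fin m)) (j : Fin m) : ℝ :=
  sSup {t | ∃ p, M.IsCompetitivePrice (M.linkWith P) p ∧ t = p j}

/-- Utility of seller `j` at transaction fee `α` when exactly the sellers in `P` join. -/
def sellerUtility (M : Market n m) (α : ℝ) (P : Finset (Fin m)) (j : Fin m) : ℝ :=
  if j ∈ P then (1 - α) * M.price P j else M.price P j

/-- Revenue of the platform at transaction fee `α` when exactly the sellers in `P` join. -/
def revenue (M : Market n m) (α : ℝ) (P : Finset (Fin m)) : ℝ :=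
  α * ∑ j ∈ P, M.price P j

/-- Expectation of `f P` when each seller `j` joins `P` independently with probability `x j`. -/
def expect (x : Fin m → ℝ) (f : Finset (Fin m) → ℝ) : ℝ :=
  ∑ P : Finset (Fin m), ((∏ j ∈ P, x j) * ∏ j ∈ Pᶜ, (1 - x j)) * f P

/-- `P` is a pure platform equilibrium at transaction fee `α`. -/
def IsPureEquilibrium (M : Market n m) (α : ℝ) (P : Finset (Fin m)) : Prop :=
  (∀ j ∈ P, M.price (P.erase j) j ≤ (1 - α) * M.price P j) ∧
    ∀ j, j ∉ P → (1 - α) * M.price (insert j P) j ≤ M.price P j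

/-- `x` is a (mixed) platform equilibrium at transaction fee `α`, where `x j` is the probability
with which seller `j` joins. In `Function.update x j 0` seller `j` stays off the platform. -/
def IsMixedEquilibrium (M : Market n m) (α : ℝ) (x : Fin m → ℝ) : Prop :=
  (∀ j, x j ∈ Set.Icc (0 : ℝ) 1) ∧
    ∀ j, max
        (expect (Function.update x j 0) fun P => M.sellerUtility α P j)
        (expect (Function.update x j 0) fun P => M.sellerUtility α (insert j P) j)
      ≤ expect x fun P => M.sellerUtility α P j

/-- The fee `α` and the pure equilibrium `P` at `α` maximize the revenue of the unregulated
platform over all fees in `[0, 1]` and all pure equilibria at that fee. -/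
def IsPureOptimal (M : Market n m) (α : ℝ) (P : Finset (Fin m)) : Prop :=
  α ∈ Set.Icc (0 : ℝ) 1 ∧ M.IsPureEquilibrium α P ∧
    ∀ β ∈ Set.Icc (0 : ℝ) 1, ∀ Q, M.IsPureEquilibrium β Q → M.revenue β Q ≤ M.revenue α P

/-- The fee `α` and the mixed equilibrium `x` at `α` maximize the expected revenue of the
unregulated platform over all fees in `[0, 1]` and all mixed equilibria at that fee. -/
def IsMixedOptimal (M : Market n m) (α : ℝ) (x : Fin m → ℝ) : Prop :=
  α ∈ Set.Icc (0 : ℝ) 1 ∧ M.IsMixedEquilibrium α x ∧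
    ∀ β ∈ Set.Icc (0 : ℝ) 1, ∀ y, M.IsMixedEquilibrium β y →
      expect y (M.revenue β) ≤ expect x (M.revenue α)

/-- Price of anarchy of the market `M` for pure platform equilibria: the worst ratio of the optimal
welfare to the welfare of a revenue-maximizing pure equilibrium. The value in `ℝ≥0∞` is `∞` if such
an equilibrium loses all of a positive optimal welfare. -/
def purePoA (M : Market n m) : ℝ≥0∞ :=
  ⨆ (α : ℝ) (P : Finset (Fin m)) (_ : M.IsPureOptimal α P),
    ENNReal.ofReal M.optimalWelfare / ENNReal.ofReal (M.welfare (M.linkWith P))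

/-- Price of anarchy of the market `M` for all (mixed) platform equilibria. -/
def mixedPoA (M : Market n m) : ℝ≥0∞ :=
  ⨆ (α : ℝ) (x : Fin m → ℝ) (_ : M.IsMixedOptimal α x),
    ENNReal.ofReal M.optimalWelfare /
      ENNReal.ofReal (expect x fun P => M.welfare (M.linkWith P))

end Market

end

/-!
In the ladder market buyer `0` values good `j < n` at about `j + 1`, and every other value is
negligible. Two neighboring goods of the ladder on the platform compete for buyer `0`, which keeps
the price of the higher one down to about the difference `1` of her values for them. Off the
platform good `j` costs at most `δ j`, where `δ` grows very quickly. If the fee leaves seller `k` so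
much that joining is worth giving up `δ k`, then every lower seller strictly prefers to join. The
sellers on the platform therefore form an initial segment of the ladder, and their prices add up to
at most `1`. Seller `0`, who sells nothing off the platform, joins even at the fee `1`, and this
alone yields the revenue `1`. So `{0}` with the fee `1` is optimal and has a welfare of about `1`,
while the optimal welfare is about `min n m`. Conversely, welfare is at least revenue, hence the
expected welfare of an optimal mixed equilibrium is at least `1`.
-/

noncomputable section

namespace Market

variable {n m : ℕ} {M : Market n m} {g : Fin n → Fin m → Prop} {P : Finset (Fin m)}

lemma sum_allocValue_le_sum {a : Fin n → Option (Fin m)} (ha : Feasible g a) {b : Fin n → ℝ}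
    (hb : ∀ i, 0 ≤ b i) (hvb : ∀ i j, g i j → M.value i j ≤ b i) :
    ∑ i, M.allocValue a i ≤ ∑ i, b i := by
  refine Finset.sum_le_sum fun i _ => ?_
  cases hi : a i with
  | none => simpa [allocValue, hi] using hb i
  | some j => simpa [allocValue, hi] using hvb i j (ha.1 i j hi)

lemma welfare_le_sum {b : Fin n → ℝ} (hb : ∀ i, 0 ≤ b i)
    (hvb : ∀ i j, g i j → M.value i j ≤ b i) : M.welfare g ≤ ∑ i, b i := by
  refine Real.sSup_le ?_ (Finset.sum_nonneg fun i _ => hb i)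
  rintro _ ⟨a, ha, rfl⟩
  exact sum_allocValue_le_sum ha hb hvb

lemma sum_allocValue_le_welfare {a : Fin n → Option (Fin m)} (ha : Feasible g a) :
    ∑ i, M.allocValue a i ≤ M.welfare g := by
  refine le_csSup ⟨∑ i, ∑ j, M.value i j, ?_⟩ ⟨a, ha, rfl⟩
  rintro _ ⟨a', ha', rfl⟩
  exact sum_allocValue_le_sum ha' (fun i => Finset.sum_nonneg fun j _ => M.value_nonneg i j)
    fun i j _ => Finset.single_le_sum (f := M.value i) (fun j _ => M.value_nonneg i j)
      (Finset.mem_univ j)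

lemma welfare_nonneg (M : Market n m) (g : Fin n → Fin m → Prop) : 0 ≤ M.welfare g := by
  simpa [allocValue] using
    sum_allocValue_le_welfare (M := M) (g := g) (a := fun _ => none) (by simp [Feasible])

lemma value_le_welfare {i : Fin n} {j : Fin m} (hij : g i j) : M.value i j ≤ M.welfare g := by
  let a : Fin n → Option (Fin m) := Function.update (fun _ => none) i (some j)
  have ha : ∀ k l, a k = some l → k = i ∧ j = l := by grind
  have hfeasible : Feasible g a := by grind [Feasible]
  calc M.value i j = M.allocValue a i := by simp [allocValue, a]
    _ = ∑ k, M.allocValue a k := by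
      refine (Finset.sum_eq_single i (fun k _ hk => ?_) (by simp)).symm
      simp [allocValue, a, hk]
    _ ≤ M.welfare g := sum_allocValue_le_welfare hfeasible

namespace IsCompetitiveEquilibrium

variable {p : Fin m → ℝ} {a : Fin n → Option (Fin m)} {i : Fin n} {j : Fin m} {C : ℝ}

lemma price_le_value (h : M.IsCompetitiveEquilibrium g p a) (hij : a i = some j) :
    p j ≤ M.value i j := by
  simpa [buyerUtility, hij] using h.utility_nonneg i

lemma value_sub_price_le (h : M.IsCompetitiveEquilibrium g p a) (hij : a i = some j) {k : Fin m}
    (hik : g i k) : M.value i k - p k ≤ M.value i j - p j := by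
  simpa [buyerUtility, hij] using h.best i k hik

lemma price_le_of_forall_buyer (h : M.IsCompetitiveEquilibrium g p a) (hC : 0 ≤ C)
    (hbuyer : ∀ i, a i = some j → p j ≤ C) : p j ≤ C := by
  by_cases hunsold : ∀ i, a i ≠ some j
  · exact (h.unsold j hunsold).trans_le hC
  · push Not at hunsold
    exact hunsold.elim hbuyer

end IsCompetitiveEquilibrium

/-- A stable outcome of the assignment game of Shapley and Shubik on the network `g`: a matching
`R` of buyers with goods, and payoffs `u` of the buyers and `p` of the goods that share the value
of every matched pair and that no linked pair can improve upon. Such outcomes certify that `p` is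
competitive without having to name an allocation function. -/
structure IsStableOutcome (M : Market n m) (g R : Fin n → Fin m → Prop) (u : Fin n → ℝ)
    (p : Fin m → ℝ) : Prop where
  link_of_match : ∀ i j, R i j → g i j
  biUnique : Relator.BiUnique R
  payoff_nonneg : ∀ i, 0 ≤ u i
  price_nonneg : ∀ j, 0 ≤ p j
  payoff_add_price : ∀ i j, R i j → u i + p j = M.value i j
  value_le : ∀ i j, g i j → M.value i j ≤ u i + p j
  payoff_eq_zero : ∀ i, (∀ j, ¬ R i j) → u i = 0
  price_eq_zero : ∀ j, (∀ i, ¬ R i j) → p j = 0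

lemma IsStableOutcome.isCompetitivePrice {R : Fin n → Fin m → Prop} {u : Fin n → ℝ}
    {p : Fin m → ℝ} (h : M.IsStableOutcome g R u p) : M.IsCompetitivePrice g p := by
  classical
  let a : Fin n → Option (Fin m) := fun i => if h : ∃ j, R i j then some h.choose else none
  have ha : ∀ i j, a i = some j ↔ R i j := by
    intro i j
    by_cases hi : ∃ j, R i j
    · simp only [a, dif_pos hi, Option.some.injEq]
      exact ⟨fun hj => hj ▸ hi.choose_spec, fun hj => h.biUnique.2 hi.choose_spec hj⟩
    · simp only [a, dif_neg hi, reduceCtorEq, false_iff]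
      exact fun hj => hi ⟨j, hj⟩
  have hutility : ∀ i, M.buyerUtility p a i = u i := by
    intro i
    cases hi : a i with
    | none =>
      have hunmatched : ∀ j, ¬ R i j := fun j hj => by simp [(ha i j).2 hj] at hi
      simp [buyerUtility, hi, h.payoff_eq_zero i hunmatched]
    | some j => simp [buyerUtility, hi, ← h.payoff_add_price i j ((ha i j).1 hi)]
  exact {
    price_nonneg := h.price_nonneg
    feasible := ⟨fun i j hij => h.link_of_match i j ((ha i j).1 hij),
      fun i i' j hi hi' => h.biUnique.1 ((ha i j).1 hi) ((ha i' j).1 hi')⟩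
    best := fun i j hij => by linarith [hutility i, h.value_le i j hij]
    utility_nonneg := fun i => (h.payoff_nonneg i).trans_eq (hutility i).symm
    unsold := fun j hj => h.price_eq_zero j fun i hij => hj i ((ha i j).2 hij) } |> .intro a

lemma price_nonneg (M : Market n m) (P : Finset (Fin m)) (j : Fin m) : 0 ≤ M.price P j := by
  refine Real.sSup_nonneg ?_
  rintro _ ⟨p, ⟨a, h⟩, rfl⟩
  exact h.price_nonneg j

lemma price_le_of_forall_buyer {j : Fin m} {C : ℝ} (hC : 0 ≤ C)
    (h : ∀ p a, M.IsCompetitiveEquilibrium (M.linkWith P) p a → ∀ i, a i = some j → p j ≤ C) :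
    M.price P j ≤ C := by
  refine Real.sSup_le ?_ hC
  rintro _ ⟨p, ⟨a, hpa⟩, rfl⟩
  exact hpa.price_le_of_forall_buyer hC (h p a hpa)

lemma price_le_of_forall_value_le {j : Fin m} {C : ℝ} (hC : 0 ≤ C)
    (h : ∀ i, M.linkWith P i j → M.value i j ≤ C) : M.price P j ≤ C :=
  price_le_of_forall_buyer hC fun _ _ hpa i hij =>
    (hpa.price_le_value hij).trans (h i (hpa.feasible.1 i j hij))

lemma IsCompetitivePrice.le_price {p : Fin m → ℝ} (h : M.IsCompetitivePrice (M.linkWith P) p)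
    (j : Fin m) : p j ≤ M.price P j := by
  refine le_csSup ⟨∑ i, M.value i j, ?_⟩ ⟨p, h, rfl⟩
  rintro _ ⟨q, ⟨a, hq⟩, rfl⟩
  refine hq.price_le_of_forall_buyer (Finset.sum_nonneg fun i _ => M.value_nonneg i j)
    fun i hij => (hq.price_le_value hij).trans ?_
  exact Finset.single_le_sum (f := fun i => M.value i j) (fun i _ => M.value_nonneg i j)
    (Finset.mem_univ i)

/-- The probability that exactly the sellers in `P` join when each seller `j` joins independently
with probability `x j`. -/
def joinProb (x : Fin m → ℝ) (P : Finset (Fin m)) : ℝ :=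
  ∏ j, if j ∈ P then x j else 1 - x j

lemma expect_eq_sum_joinProb (x : Fin m → ℝ) (f : Finset (Fin m) → ℝ) :
    expect x f = ∑ P, joinProb x P * f P := by
  refine Finset.sum_congr rfl fun P _ => ?_
  rw [joinProb, Finset.prod_ite, Finset.filter_univ_mem, Finset.filter_not, Finset.filter_univ_mem,
    ← Finset.compl_eq_univ_sdiff]

lemma joinProb_nonneg {x : Fin m → ℝ} (hx : ∀ j, x j ∈ Set.Icc (0 : ℝ) 1)
    (P : Finset (Fin m)) : 0 ≤ joinProb x P := by
  refine Finset.prod_nonneg fun j _ => ?_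
  split_ifs
  exacts [(hx j).1, sub_nonneg.2 (hx j).2]

lemma ne_zero_of_joinProb_ne_zero {x : Fin m → ℝ} (hP : joinProb x P ≠ 0) {j : Fin m}
    (hj : j ∈ P) : x j ≠ 0 := by
  simpa [hj] using Finset.prod_ne_zero_iff.1 hP j (Finset.mem_univ j)

lemma ne_one_of_joinProb_ne_zero {x : Fin m → ℝ} (hP : joinProb x P ≠ 0) {j : Fin m}
    (hj : j ∉ P) : x j ≠ 1 := by
  have hfactor := Finset.prod_ne_zero_iff.1 hP j (Finset.mem_univ j)
  rw [if_neg hj, sub_ne_zero] at hfactor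
  exact hfactor.symm

lemma notMem_of_joinProb_update_ne_zero {x : Fin m → ℝ} {j : Fin m}
    (hP : joinProb (Function.update x j 0) P ≠ 0) : j ∉ P := fun hj =>
  ne_zero_of_joinProb_ne_zero hP hj (Function.update_self ..)

lemma expect_const (x : Fin m → ℝ) (C : ℝ) : expect x (fun _ => C) = C := by
  have h := Fintype.prod_add x fun j => 1 - x j
  simp only [add_sub_cancel, Finset.prod_const_one] at h
  rw [expect, ← Finset.sum_mul, ← h, one_mul]

lemma expect_mono {x : Fin m → ℝ} (hx : ∀ j, x j ∈ Set.Icc (0 : ℝ) 1)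
    {f f' : Finset (Fin m) → ℝ} (h : ∀ P, joinProb x P ≠ 0 → f P ≤ f' P) :
    expect x f ≤ expect x f' := by
  rw [expect_eq_sum_joinProb, expect_eq_sum_joinProb]
  refine Finset.sum_le_sum fun P _ => ?_
  by_cases hP : joinProb x P = 0
  · simp [hP]
  · exact mul_le_mul_of_nonneg_left (h P hP) (joinProb_nonneg hx P)

lemma expect_le {x : Fin m → ℝ} (hx : ∀ j, x j ∈ Set.Icc (0 : ℝ) 1)
    {f : Finset (Fin m) → ℝ} {C : ℝ} (h : ∀ P, joinProb x P ≠ 0 → f P ≤ C) : expect x f ≤ C :=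
  (expect_mono hx h).trans_eq (expect_const x C)

lemma le_expect {x : Fin m → ℝ} (hx : ∀ j, x j ∈ Set.Icc (0 : ℝ) 1)
    {f : Finset (Fin m) → ℝ} {C : ℝ} (h : ∀ P, joinProb x P ≠ 0 → C ≤ f P) : C ≤ expect x f :=
  (expect_const x C).symm.trans_le (expect_mono hx h)

lemma joinProb_eq_mul_joinProb_update (x : Fin m → ℝ) (j : Fin m) (P : Finset (Fin m)) :
    joinProb x P =
      (if j ∈ P then x j else 1 - x j) * joinProb (Function.update x j 0) (P.erase j) := by
  rw [joinProb, joinProb, ← Finset.mul_prod_erase _ _ (Finset.mem_univ j),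
    ← Finset.mul_prod_erase _ _ (Finset.mem_univ j)]
  simp only [Finset.notMem_erase, if_false, Function.update_self, sub_zero, one_mul]
  congr 1
  refine Finset.prod_congr rfl fun k hk => ?_
  simp [Finset.ne_of_mem_erase hk]

lemma expect_eq_add_expect_update (x : Fin m → ℝ) (j : Fin m) (f : Finset (Fin m) → ℝ) :
    expect x f = (1 - x j) * expect (Function.update x j 0) f +
      x j * expect (Function.update x j 0) fun P => f (insert j P) := by
  have hsplit (F : Finset (Fin m) → ℝ) :
      ∑ P, F P = ∑ P ∈ (Finset.univ.erase j).powerset, (F P + F (insert j P)) := by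
    have h := Finset.sum_powerset_insert (Finset.notMem_erase j Finset.univ) F
    rwa [Finset.insert_erase (Finset.mem_univ j), Finset.powerset_univ,
      ← Finset.sum_add_distrib] at h
  simp only [expect_eq_sum_joinProb]
  rw [hsplit, hsplit fun P => joinProb (Function.update x j 0) P * f P,
    hsplit fun P => joinProb (Function.update x j 0) P * f (insert j P),
    Finset.mul_sum, Finset.mul_sum, ← Finset.sum_add_distrib]
  refine Finset.sum_congr rfl fun P hP => ?_
  have hj : j ∉ P := fun hj => by simpa using Finset.mem_powerset.1 hP hj
  have hinsert : joinProb (Function.update x j 0) (insert j P) = 0 :=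
    not_not.1 fun h => notMem_of_joinProb_update_ne_zero h (Finset.mem_insert_self j P)
  rw [joinProb_eq_mul_joinProb_update x j P, joinProb_eq_mul_joinProb_update x j (insert j P),
    hinsert]
  simp only [hj, if_false, Finset.mem_insert_self, if_true, Finset.erase_insert hj,
    Finset.erase_eq_of_notMem hj]
  ring

/-- The joining probabilities with which exactly the sellers in `P` join, almost surely. -/
def pureProfile (P : Finset (Fin m)) (j : Fin m) : ℝ :=
  if j ∈ P then 1 else 0

lemma pureProfile_mem_Icc (P : Finset (Fin m)) (j : Fin m) :
    pureProfile P j ∈ Set.Icc (0 : ℝ) 1 := by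
  unfold pureProfile
  split_ifs <;> simp

lemma eq_of_joinProb_pureProfile_ne_zero {Q : Finset (Fin m)}
    (hQ : joinProb (pureProfile P) Q ≠ 0) : Q = P := by
  ext j
  have hmem := ne_zero_of_joinProb_ne_zero hQ (j := j)
  have hnotMem := ne_one_of_joinProb_ne_zero hQ (j := j)
  grind [pureProfile]

lemma expect_pureProfile (P : Finset (Fin m)) (f : Finset (Fin m) → ℝ) :
    expect (pureProfile P) f = f P :=
  le_antisymm
    (expect_le (pureProfile_mem_Icc P) fun _ hQ =>
      (congrArg f (eq_of_joinProb_pureProfile_ne_zero hQ)).le)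
    (le_expect (pureProfile_mem_Icc P) fun _ hQ =>
      (congrArg f (eq_of_joinProb_pureProfile_ne_zero hQ)).ge)

lemma update_pureProfile (P : Finset (Fin m)) (j : Fin m) :
    Function.update (pureProfile P) j 0 = pureProfile (P.erase j) := by
  ext k
  by_cases hk : k = j <;> simp [pureProfile, hk]

variable {α : ℝ} {x : Fin m → ℝ}

lemma IsPureEquilibrium.isMixedEquilibrium (h : M.IsPureEquilibrium α P) :
    M.IsMixedEquilibrium α (pureProfile P) := by
  refine ⟨pureProfile_mem_Icc P, fun j => ?_⟩
  rw [update_pureProfile, expect_pureProfile, expect_pureProfile, expect_pureProfile]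
  by_cases hj : j ∈ P
  · simp [sellerUtility, hj, Finset.insert_erase hj, h.1 j hj]
  · simp [sellerUtility, hj, h.2 j hj]

lemma IsMixedOptimal.isPureOptimal (h : M.IsMixedOptimal α (pureProfile P))
    (hP : M.IsPureEquilibrium α P) : M.IsPureOptimal α P :=
  ⟨h.1, hP, fun β hβ Q hQ => by
    simpa only [expect_pureProfile] using h.2.2 β hβ _ hQ.isMixedEquilibrium⟩

lemma IsPureOptimal.isMixedOptimal (hP : M.IsPureOptimal α P) {β : ℝ} {Q : Finset (Fin m)}
    (hQ : M.IsPureEquilibrium β Q) (hopt : M.IsMixedOptimal β (pureProfile Q)) :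
    M.IsMixedOptimal α (pureProfile P) := by
  refine ⟨hP.1, hP.2.1.isMixedEquilibrium, fun γ hγ y hy => (hopt.2.2 γ hγ y hy).trans ?_⟩
  rw [expect_pureProfile, expect_pureProfile]
  exact hP.2.2 β hopt.1 Q hQ

lemma IsPureOptimal.div_le_purePoA (h : M.IsPureOptimal α P) :
    ENNReal.ofReal M.optimalWelfare / ENNReal.ofReal (M.welfare (M.linkWith P)) ≤ M.purePoA :=
  le_iSup_of_le α (le_iSup_of_le P (le_iSup_of_le h le_rfl))

lemma IsMixedOptimal.purePoA_le_mixedPoA (hopt : M.IsMixedOptimal α (pureProfile P))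
    (hP : M.IsPureEquilibrium α P) : M.purePoA ≤ M.mixedPoA := by
  refine iSup_le fun β => iSup_le fun Q => iSup_le fun hQ => ?_
  refine le_iSup_of_le β (le_iSup_of_le (pureProfile Q)
    (le_iSup_of_le (hQ.isMixedOptimal hP hopt) ?_))
  rw [expect_pureProfile]

/-- The expected price of seller `j` off the platform, when the others join according to `x`. -/
def offPrice (M : Market n m) (x : Fin m → ℝ) (j : Fin m) : ℝ :=
  expect (Function.update x j 0) fun P => M.price P j

/-- The expected price of seller `j` on the platform, when the others join according to `x`. -/
def onPrice (M : Market n m) (x : Fin m → ℝ) (j : Fin m) : ℝ :=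
  expect (Function.update x j 0) fun P => M.price (insert j P) j

lemma update_zero_mem_Icc (hx : ∀ j, x j ∈ Set.Icc (0 : ℝ) 1) (j k : Fin m) :
    Function.update x j 0 k ∈ Set.Icc (0 : ℝ) 1 := by
  by_cases hk : k = j
  · simp [hk]
  · simpa [hk] using hx k

lemma expect_update_sellerUtility (M : Market n m) (α : ℝ) (x : Fin m → ℝ) (j : Fin m) :
    expect (Function.update x j 0) (fun P => M.sellerUtility α P j) = M.offPrice x j := by
  rw [offPrice, expect_eq_sum_joinProb, expect_eq_sum_joinProb]
  refine Finset.sum_congr rfl fun P _ => ?_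
  by_cases hP : joinProb (Function.update x j 0) P = 0
  · simp [hP]
  · rw [sellerUtility, if_neg (notMem_of_joinProb_update_ne_zero hP)]

lemma expect_update_sellerUtility_insert (M : Market n m) (α : ℝ) (x : Fin m → ℝ) (j : Fin m) :
    expect (Function.update x j 0) (fun P => M.sellerUtility α (insert j P) j) =
      (1 - α) * M.onPrice x j := by
  simp only [sellerUtility, Finset.mem_insert_self, if_true, onPrice, expect, Finset.mul_sum,
    mul_left_comm]

namespace IsMixedEquilibrium

variable {j : Fin m}

lemma max_le (h : M.IsMixedEquilibrium α x) (j : Fin m) :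
    max (M.offPrice x j) ((1 - α) * M.onPrice x j) ≤
      (1 - x j) * M.offPrice x j + x j * ((1 - α) * M.onPrice x j) := by
  simpa only [expect_update_sellerUtility, expect_update_sellerUtility_insert] using
    (h.2 j).trans_eq (expect_eq_add_expect_update x j fun P => M.sellerUtility α P j)

lemma offPrice_le_of_pos (h : M.IsMixedEquilibrium α x) (hj : 0 < x j) :
    M.offPrice x j ≤ (1 - α) * M.onPrice x j := by
  have hoff := (max_le_iff.1 (h.max_le j)).1
  exact le_of_mul_le_mul_left (by linarith) hj

lemma eq_one_of_offPrice_lt (h : M.IsMixedEquilibrium α x)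
    (hj : M.offPrice x j < (1 - α) * M.onPrice x j) : x j = 1 := by
  have hon := (max_le_iff.1 (h.max_le j)).2
  refine le_antisymm (h.1 j).2 (le_of_mul_le_mul_right ?_ (sub_pos.2 hj))
  linarith

end IsMixedEquilibrium

end Market

/-- The scale `ε` of the small values in a ladder market with `n` buyers. -/
structure LadderScale (n : ℕ) where
  ε : ℝ
  ε_pos : 0 < ε
  four_mul_le_one : 4 * (n * ε) ≤ 1

open Market

namespace LadderScale

variable {n m : ℕ} (q : LadderScale n)

/-- The difference of the values of buyer `0` for consecutive goods, chosen such that one `step`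
and `n` times `ε` add up to her value `1` for good `0`. -/
def step : ℝ := 1 - n * q.ε

/-- The value of buyer `0` for good `j`. -/
def top (j : ℕ) : ℝ := 1 + j * q.step

/-- The value of good `j` off the platform. Above good `0`, which nobody can buy there, these values
grow so quickly that `δ k` dwarfs `δ j` for `j < k`, even relative to the scale `ε`. -/
def δ (j : ℕ) : ℝ := if j = 0 then 0 else q.ε ^ (2 * (n - j))

lemma δ_zero : q.δ 0 = 0 := rfl

lemma δ_pos {j : ℕ} (hj : 1 ≤ j) : 0 < q.δ j := by
  rw [δ, if_neg (by omega)]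
  exact pow_pos q.ε_pos _

lemma δ_nonneg (j : ℕ) : 0 ≤ q.δ j := by
  rcases Nat.eq_zero_or_pos j with rfl | hj
  exacts [q.δ_zero.ge, (q.δ_pos hj).le]

lemma step_ge : 3 / 4 ≤ q.step := by
  unfold step
  linarith [q.four_mul_le_one]

lemma step_le_one : q.step ≤ 1 :=
  sub_le_self 1 (mul_nonneg n.cast_nonneg q.ε_pos.le)

lemma one_le_top (j : ℕ) : 1 ≤ q.top j :=
  le_add_of_nonneg_right (mul_nonneg j.cast_nonneg (by linarith [q.step_ge]))

lemma top_add_step_le {j k : ℕ} (hjk : j < k) : q.top j + q.step ≤ q.top k := by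
  have hcast : (j : ℝ) + 1 ≤ k := by exact_mod_cast hjk
  have hstep := q.step_ge
  unfold top
  nlinarith

lemma top_mono : Monotone q.top := monotone_nat_of_le_succ fun j => by
  linarith [q.top_add_step_le j.lt_succ_self, q.step_ge]

lemma top_le {j : ℕ} (hj : j < n) : q.top j ≤ n := by
  have hcast : (j : ℝ) + 1 ≤ n := by exact_mod_cast hj
  have hmul := mul_le_of_le_one_right (Nat.cast_nonneg (α := ℝ) j) q.step_le_one
  unfold top
  linarith

/-- The ladder market. Buyer `0` values good `j` at `top j`, buyer `j + 1` values it at `ε`, and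
seller `j ≥ 1` is linked to buyer `j` only, who values good `j` at `δ j`. The goods `j ≥ n` are
worthless. -/
def ladder (m : ℕ) : Market n m where
  value i j :=
    if (i : ℕ) = 0 then if (j : ℕ) < n then q.top j else 0
    else if (i : ℕ) = j + 1 then q.ε
    else if (i : ℕ) = j then q.δ j else 0
  value_nonneg i j := by
    have hε := q.ε_pos
    have hδ := q.δ_nonneg j
    have htop := q.one_le_top j
    split_ifs <;> linarith
  link i j := 1 ≤ (i : ℕ) ∧ (i : ℕ) = j

variable {i : Fin n} {j k : Fin m} {P : Finset (Fin m)}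

lemma linkWith_iff : (q.ladder m).linkWith P i j ↔ j ∈ P ∨ 1 ≤ (i : ℕ) ∧ (i : ℕ) = j := Iff.rfl

lemma value_eq_top (hi : (i : ℕ) = 0) (hj : (j : ℕ) < n) : (q.ladder m).value i j = q.top j := by
  simp [ladder, hi, hj]

lemma value_eq_ε (hij : (i : ℕ) = j + 1) : (q.ladder m).value i j = q.ε := by
  simp [ladder, hij]

lemma value_eq_δ (hi : 1 ≤ (i : ℕ)) (hij : (i : ℕ) = j) : (q.ladder m).value i j = q.δ j := by
  simp [ladder, ← hij, Nat.one_le_iff_ne_zero.1 hi]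

lemma value_eq_zero_of_le (i : Fin n) (hj : n ≤ j) : (q.ladder m).value i j = 0 := by
  grind [ladder]

lemma value_eq_zero_of_ne (hi : (i : ℕ) ≠ 0) (hij : (i : ℕ) ≠ j + 1) (hij' : (i : ℕ) ≠ j) :
    (q.ladder m).value i j = 0 := by
  simp [ladder, hi, hij, hij']

section

variable [NeZero n]

lemma ε_le : q.ε ≤ 1 / 4 := by
  have hn : (1 : ℝ) ≤ n := by exact_mod_cast NeZero.one_le
  linarith [q.four_mul_le_one, le_mul_of_one_le_left q.ε_pos.le hn]

lemma δ_le {j : ℕ} (hj : j < n) : q.δ j ≤ q.ε / 2 := by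
  have hε := q.ε_pos
  have hε' := q.ε_le
  unfold δ
  split_ifs
  · linarith
  · calc q.ε ^ (2 * (n - j)) ≤ q.ε ^ 2 :=
          pow_le_pow_of_le_one hε.le (by linarith) (by omega)
      _ ≤ q.ε / 2 := by nlinarith

lemma two_mul_δ_lt {j k : ℕ} (hjk : j < k) (hk : k < n) : 2 * n * q.δ j < q.ε * q.δ k := by
  have hε := q.ε_pos
  have hδ := q.δ_pos (show 1 ≤ k by omega)
  have hratio : q.δ j ≤ q.ε ^ 2 * q.δ k := by
    rcases Nat.eq_zero_or_pos j with rfl | hj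
    · rw [δ_zero]
      positivity
    · rw [δ, δ, if_neg (by omega), if_neg (by omega), ← pow_add]
      exact pow_le_pow_of_le_one hε.le (by linarith [q.ε_le]) (by omega)
  calc 2 * n * q.δ j ≤ 2 * n * (q.ε ^ 2 * q.δ k) := by gcongr
    _ = 2 * (n * q.ε) * (q.ε * q.δ k) := by ring
    _ ≤ 1 / 2 * (q.ε * q.δ k) := by
      gcongr
      linarith [q.four_mul_le_one]
    _ < q.ε * q.δ k := by linarith [mul_pos hε hδ]

lemma value_le_ε (j : Fin m) (hi : (i : ℕ) ≠ 0) : (q.ladder m).value i j ≤ q.ε := by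
  have hε := q.ε_pos
  simp only [ladder, hi, if_false]
  split_ifs with hsucc hself
  · exact le_rfl
  · linarith [q.δ_le (hself ▸ i.isLt)]
  · exact hε.le

lemma value_le_half_ε (hi : (i : ℕ) ≠ 0) (hij : (i : ℕ) ≠ j + 1) :
    (q.ladder m).value i j ≤ q.ε / 2 := by
  by_cases hself : (i : ℕ) = j
  · exact (q.value_eq_δ (Nat.one_le_iff_ne_zero.2 hi) hself).trans_le (q.δ_le (hself ▸ i.isLt))
  · exact (q.value_eq_zero_of_ne hi hij hself).trans_le (half_pos q.ε_pos).le

lemma value_le_top (i : Fin n) (j : Fin m) : (q.ladder m).value i j ≤ q.top j := by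
  have htop := q.one_le_top j
  by_cases hi : (i : ℕ) = 0
  · simp only [ladder, hi, if_true]
    split_ifs <;> linarith
  · linarith [q.value_le_ε j hi, q.ε_le]

end

/-- Some seller on the platform ranks above `j` on the ladder. -/
def IsOutranked (n : ℕ) (P : Finset (Fin m)) (j : Fin m) : Prop :=
  ∃ k ∈ P, j < k ∧ (k : ℕ) < n

/-- Seller `j` is the highest one of the ladder on the platform. -/
def IsHighest (n : ℕ) (P : Finset (Fin m)) (j : Fin m) : Prop :=
  j ∈ P ∧ (j : ℕ) < n ∧ ¬ IsOutranked n P j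

lemma IsHighest.le (hk : IsHighest n P k) (hj : j ∈ P) (hjn : (j : ℕ) < n) : j ≤ k :=
  not_lt.1 fun hkj => hk.2.2 ⟨j, hj, hkj, hjn⟩

lemma IsHighest.isOutranked (hk : IsHighest n P k) (hjk : j < k) : IsOutranked n P j :=
  ⟨k, hk.1, hjk, hk.2.1⟩

lemma IsOutranked.lt (hj : IsOutranked n P j) : (j : ℕ) < n := by
  obtain ⟨k, -, hjk, hkn⟩ := hj
  omega

lemma exists_isHighest (hj : j ∈ P) (hjn : (j : ℕ) < n) : ∃ k, IsHighest n P k := by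
  obtain ⟨k, hk, hmax⟩ := (P.filter fun j : Fin m => (j : ℕ) < n).exists_max_image id
    ⟨j, Finset.mem_filter.2 ⟨hj, hjn⟩⟩
  rw [Finset.mem_filter] at hk
  exact ⟨k, hk.1, hk.2, fun ⟨l, hl, hkl, hln⟩ =>
    (hmax l (Finset.mem_filter.2 ⟨hl, hln⟩)).not_gt hkl⟩

/-- Buyer `i` is the one who values at `ε` a good on the platform that buyer `0` forgoes for a
higher one. -/
def IsFallback (n : ℕ) (P : Finset (Fin m)) (i : ℕ) : Prop :=
  ∃ j ∈ P, (j : ℕ) + 1 = i ∧ IsOutranked n P j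

/-- The second highest value of buyer `0` for a good of the ladder on the platform; it is `0`, the
supremum of the empty family, if there are fewer than two such goods. -/
def secondTop (P : Finset (Fin m)) : ℝ :=
  ⨆ j : {j : Fin m // j ∈ P ∧ IsOutranked n P j}, q.top j

/-- The matching of the canonical stable outcome: buyer `0` buys from the highest seller on the
platform, the fallback buyers from the lower ones, and the sellers off the platform sell to their
neighbor unless she is a fallback buyer. -/
def Matched (P : Finset (Fin m)) (i : Fin n) (j : Fin m) : Prop :=
  ((i : ℕ) = 0 ∧ IsHighest n P j) ∨ ((i : ℕ) = j + 1 ∧ j ∈ P ∧ IsOutranked n P j) ∨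
    (1 ≤ (i : ℕ) ∧ (i : ℕ) = j ∧ j ∉ P ∧ ¬ IsFallback n P j)

open scoped Classical in
/-- The payoffs of the buyers in the canonical stable outcome. -/
def stablePayoff (P : Finset (Fin m)) (i : Fin n) : ℝ :=
  if (i : ℕ) = 0 then q.secondTop P else if IsFallback n P i then q.ε / 2 else 0

open scoped Classical in
/-- The prices of the canonical stable outcome. -/
def stablePrice (P : Finset (Fin m)) (j : Fin m) : ℝ :=
  if IsHighest n P j then q.top j - q.secondTop P
  else if j ∈ P ∧ IsOutranked n P j then q.ε / 2
  else if 1 ≤ (j : ℕ) ∧ (j : ℕ) < n ∧ j ∉ P ∧ ¬ IsFallback n P j then q.δ j else 0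

lemma secondTop_nonneg (P : Finset (Fin m)) : 0 ≤ q.secondTop P :=
  Real.iSup_nonneg fun j => by linarith [q.one_le_top j]

lemma secondTop_eq_zero (h : ∀ j ∈ P, ¬ IsOutranked n P j) : q.secondTop P = 0 := by
  have : IsEmpty {j : Fin m // j ∈ P ∧ IsOutranked n P j} := ⟨fun j => h j j.2.1 j.2.2⟩
  exact Real.iSup_of_isEmpty _

lemma top_le_secondTop (hj : j ∈ P) (hout : IsOutranked n P j) : q.top j ≤ q.secondTop P :=
  le_ciSup (f := fun l : {l : Fin m // l ∈ P ∧ IsOutranked n P l} => q.top l)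
    (Set.finite_range _).bddAbove ⟨j, hj, hout⟩

lemma secondTop_add_step_le (hk : IsHighest n P k) : q.secondTop P + q.step ≤ q.top k := by
  rw [← le_sub_iff_add_le]
  refine Real.iSup_le (fun ⟨j, hj, hout⟩ => ?_) (by linarith [q.one_le_top k, q.step_le_one])
  have hjk : j ≠ k := by
    rintro rfl
    exact hk.2.2 hout
  exact le_sub_iff_add_le.2 (q.top_add_step_le ((hk.le hj hout.lt).lt_of_ne hjk))

lemma stablePrice_of_isHighest (hj : IsHighest n P j) :
    q.stablePrice P j = q.top j - q.secondTop P := if_pos hj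

lemma stablePrice_of_isOutranked (hj : j ∈ P) (hout : IsOutranked n P j) :
    q.stablePrice P j = q.ε / 2 := by
  rw [stablePrice, if_neg fun h => h.2.2 hout, if_pos ⟨hj, hout⟩]

lemma stablePrice_of_notMem (hj1 : 1 ≤ (j : ℕ)) (hjn : (j : ℕ) < n) (hj : j ∉ P)
    (hfree : ¬ IsFallback n P j) : q.stablePrice P j = q.δ j := by
  rw [stablePrice, if_neg fun h => hj h.1, if_neg fun h => hj h.1, if_pos ⟨hj1, hjn, hj, hfree⟩]

lemma stablePayoff_of_isFallback (hi : IsFallback n P i) : q.stablePayoff P i = q.ε / 2 := by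
  have hi0 : (i : ℕ) ≠ 0 := by
    obtain ⟨j, -, hji, -⟩ := hi
    omega
  rw [stablePayoff, if_neg hi0, if_pos hi]

lemma stablePayoff_nonneg (P : Finset (Fin m)) (i : Fin n) : 0 ≤ q.stablePayoff P i := by
  have hε := q.ε_pos
  have hsecond := q.secondTop_nonneg P
  unfold stablePayoff
  split_ifs <;> linarith

lemma stablePrice_nonneg (P : Finset (Fin m)) (j : Fin m) : 0 ≤ q.stablePrice P j := by
  have hε := q.ε_pos
  have hδ := q.δ_nonneg j
  unfold stablePrice
  split_ifs with h
  · linarith [q.secondTop_add_step_le h, q.step_ge]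
  all_goals linarith

lemma step_le_stablePrice (hj : IsHighest n P j) : q.step ≤ q.stablePrice P j := by
  rw [q.stablePrice_of_isHighest hj]
  linarith [q.secondTop_add_step_le hj]

lemma top_le_stablePayoff_add_stablePrice (hi : (i : ℕ) = 0) (hj : j ∈ P) (hjn : (j : ℕ) < n) :
    q.top j ≤ q.stablePayoff P i + q.stablePrice P j := by
  rw [stablePayoff, if_pos hi]
  by_cases hout : IsOutranked n P j
  · linarith [q.top_le_secondTop hj hout, q.stablePrice_nonneg P j]
  · rw [q.stablePrice_of_isHighest ⟨hj, hjn, hout⟩, add_sub_cancel]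

lemma link_of_matched (h : Matched P i j) : (q.ladder m).linkWith P i j := by
  rcases h with ⟨-, hhighest⟩ | ⟨-, hj, -⟩ | ⟨hi, hij, -, -⟩
  exacts [Or.inl hhighest.1, Or.inl hj, Or.inr ⟨hi, hij⟩]

lemma matched_biUnique (P : Finset (Fin m)) :
    Relator.BiUnique (Matched P : Fin n → Fin m → Prop) := by
  constructor
  · intro i j i' h h'
    grind [Matched, IsHighest]
  · intro i j j' h h'
    have hle : IsHighest n P j → IsHighest n P j' → j = j' := fun hj hj' =>
      le_antisymm (hj'.le hj.1 hj.2.1) (hj.le hj'.1 hj'.2.1)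
    grind [Matched, IsFallback]

lemma stablePayoff_add_stablePrice (h : Matched P i j) :
    q.stablePayoff P i + q.stablePrice P j = (q.ladder m).value i j := by
  rcases h with ⟨hi, hhighest⟩ | ⟨hij, hj, hout⟩ | ⟨hi, hij, hj, hfree⟩
  · rw [q.stablePrice_of_isHighest hhighest, q.value_eq_top hi hhighest.2.1, stablePayoff,
      if_pos hi]
    ring
  · rw [q.stablePrice_of_isOutranked hj hout, q.value_eq_ε hij,
      q.stablePayoff_of_isFallback ⟨j, hj, hij.symm, hout⟩]
    ring
  · rw [q.stablePrice_of_notMem (hij ▸ hi) (hij ▸ i.isLt) hj hfree, q.value_eq_δ hi hij,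
      stablePayoff, if_neg (by omega), if_neg (hij ▸ hfree), zero_add]

lemma value_le_stablePayoff_add_stablePrice [NeZero n] (h : (q.ladder m).linkWith P i j) :
    (q.ladder m).value i j ≤ q.stablePayoff P i + q.stablePrice P j := by
  have hε := q.ε_pos
  have hpayoff := q.stablePayoff_nonneg P i
  have hprice := q.stablePrice_nonneg P j
  rcases le_or_gt n (j : ℕ) with hjn | hjn
  · rw [q.value_eq_zero_of_le i hjn]
    positivity
  by_cases hj : j ∈ P
  · by_cases hi : (i : ℕ) = 0
    · have htop := q.top_le_stablePayoff_add_stablePrice hi hj hjn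
      rwa [q.value_eq_top hi hjn]
    by_cases hout : IsOutranked n P j
    · rw [q.stablePrice_of_isOutranked hj hout]
      by_cases hij : (i : ℕ) = j + 1
      · rw [q.value_eq_ε hij, q.stablePayoff_of_isFallback ⟨j, hj, hij.symm, hout⟩, add_halves]
      · linarith [q.value_le_half_ε hi hij]
    · have hstep := q.step_le_stablePrice ⟨hj, hjn, hout⟩
      linarith [q.value_le_ε j hi, q.ε_le, q.step_ge]
  · obtain ⟨hi, hij⟩ := (q.linkWith_iff.1 h).resolve_left hj
    rw [q.value_eq_δ hi hij]
    by_cases hfallback : IsFallback n P j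
    · rw [q.stablePayoff_of_isFallback (hij ▸ hfallback)]
      linarith [q.δ_le hjn]
    · rw [q.stablePrice_of_notMem (hij ▸ hi) hjn hj hfallback]
      linarith

lemma stablePayoff_eq_zero (h : ∀ j, ¬ Matched P i j) : q.stablePayoff P i = 0 := by
  unfold stablePayoff
  split_ifs with hi hfallback
  · refine q.secondTop_eq_zero fun j hj hout => ?_
    obtain ⟨k, hk⟩ := exists_isHighest hj hout.lt
    exact h k (Or.inl ⟨hi, hk⟩)
  · obtain ⟨j, hj, hji, hout⟩ := hfallback
    exact absurd (Or.inr (Or.inl ⟨hji.symm, hj, hout⟩)) (h j)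
  · rfl

lemma stablePrice_eq_zero (h : ∀ i : Fin n, ¬ Matched P i j) : q.stablePrice P j = 0 := by
  unfold stablePrice
  split_ifs with hhighest hout hoff
  · exact absurd (Or.inl ⟨rfl, hhighest⟩) (h ⟨0, by have := hhighest.2.1; omega⟩)
  · obtain ⟨k, -, hjk, hkn⟩ := hout.2
    exact absurd (Or.inr (Or.inl ⟨rfl, hout⟩)) (h ⟨j + 1, by omega⟩)
  · exact absurd (Or.inr (Or.inr ⟨hoff.1, rfl, hoff.2.2⟩)) (h ⟨j, hoff.2.1⟩)
  · rfl

lemma stablePrice_le_price [NeZero n] (P : Finset (Fin m)) (j : Fin m) :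
    q.stablePrice P j ≤ (q.ladder m).price P j :=
  IsCompetitivePrice.le_price (p := q.stablePrice P) (IsStableOutcome.isCompetitivePrice
    { link_of_match := fun _ _ => q.link_of_matched
      biUnique := matched_biUnique P
      payoff_nonneg := q.stablePayoff_nonneg P
      price_nonneg := q.stablePrice_nonneg P
      payoff_add_price := fun _ _ => q.stablePayoff_add_stablePrice
      value_le := fun _ _ => q.value_le_stablePayoff_add_stablePrice
      payoff_eq_zero := fun _ => q.stablePayoff_eq_zero
      price_eq_zero := fun _ => q.stablePrice_eq_zero }) j

lemma price_le_top (P : Finset (Fin m)) (j : Fin m) [NeZero n] :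
    (q.ladder m).price P j ≤ q.top j :=
  price_le_of_forall_value_le (by linarith [q.one_le_top j]) fun i _ => q.value_le_top i j

lemma price_eq_zero_of_le (P : Finset (Fin m)) (hj : n ≤ j) : (q.ladder m).price P j = 0 :=
  (price_le_of_forall_value_le le_rfl fun i _ => (q.value_eq_zero_of_le i hj).le).antisymm
    (price_nonneg _ P j)

lemma price_le_δ (hj : j ∉ P) : (q.ladder m).price P j ≤ q.δ j :=
  price_le_of_forall_value_le (q.δ_nonneg j) fun i h => by
    obtain ⟨hi, hij⟩ := (q.linkWith_iff.1 h).resolve_left hj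
    exact (q.value_eq_δ hi hij).le

lemma isPureEquilibrium_one_singleton_zero [NeZero m] :
    (q.ladder m).IsPureEquilibrium 1 {0} := by
  refine ⟨fun j hj => ?_, fun j _ => ?_⟩
  · obtain rfl := Finset.mem_singleton.1 hj
    simpa [δ_zero] using q.price_le_δ (Finset.notMem_erase (0 : Fin m) {0})
  · simpa using price_nonneg _ _ j

section

variable [NeZero n]

lemma price_le_ε_add_max (hk : k ∈ P) (hkn : (k : ℕ) < n) (hkj : k ≠ j) :
    (q.ladder m).price P j ≤ q.ε + max 0 (q.top j - q.top k) := by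
  have hmax := le_max_left 0 (q.top j - q.top k)
  have hmax' := le_max_right 0 (q.top j - q.top k)
  have hε := q.ε_pos
  refine price_le_of_forall_buyer (by positivity) fun p a hpa i hij => ?_
  have hvalue := hpa.price_le_value hij
  by_cases hi : (i : ℕ) = 0
  · -- Buyer `0` does not buy good `k`, which therefore costs her at most `ε`.
    have hpk : p k ≤ q.ε := hpa.price_le_of_forall_buyer hε.le fun i' hi' => by
      have hne : (i' : ℕ) ≠ 0 := fun h => hkj (by
        rw [Fin.ext (h.trans hi.symm), hij] at hi'
        exact (Option.some.inj hi').symm)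
      exact (hpa.price_le_value hi').trans (q.value_le_ε k hne)
    have hbest := hpa.value_sub_price_le hij (k := k) (Or.inl hk)
    rw [q.value_eq_top hi hkn] at hbest
    linarith [q.value_le_top i j]
  · linarith [q.value_le_ε j hi]

lemma price_le_ε (hj : IsOutranked n P j) : (q.ladder m).price P j ≤ q.ε := by
  obtain ⟨k, hk, hjk, hkn⟩ := hj
  have htop : q.top j - q.top k ≤ 0 := sub_nonpos.2 (q.top_mono hjk.le)
  simpa [max_eq_left htop] using q.price_le_ε_add_max hk hkn hjk.ne'

lemma price_le_step_add_ε (hj : j ∈ P) (hjk : (j : ℕ) + 1 = k) (hkn : (k : ℕ) < n) :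
    (q.ladder m).price P k ≤ q.step + q.ε := by
  have htop : q.top k - q.top j = q.step := by
    rw [top, top, ← hjk]
    push_cast
    ring
  have hprice := q.price_le_ε_add_max (j := k) hj (by omega) (by omega)
  rwa [htop, max_eq_right (by linarith [q.step_ge]), add_comm] at hprice

lemma half_ε_le_price (hj : j ∈ P) (hjn : (j : ℕ) < n) : q.ε / 2 ≤ (q.ladder m).price P j := by
  refine le_trans ?_ (q.stablePrice_le_price P j)
  by_cases hout : IsOutranked n P j
  · exact (q.stablePrice_of_isOutranked hj hout).ge
  · linarith [q.step_le_stablePrice ⟨hj, hjn, hout⟩, q.step_ge, q.ε_le, q.ε_pos]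

lemma δ_le_price (hk : 1 ≤ (k : ℕ)) (hkn : (k : ℕ) < n)
    (hP : ∀ j ∈ P, (j : ℕ) < n → j < k) : q.δ k ≤ (q.ladder m).price P k := by
  have hkP : k ∉ P := fun h => (hP k h hkn).false
  have hfree : ¬ IsFallback n P k := by
    rintro ⟨j, -, hjk, l, hl, hjl, hln⟩
    have := hP l hl hln
    omega
  exact (q.stablePrice_of_notMem hk hkn hkP hfree).symm.trans_le (q.stablePrice_le_price P k)

lemma one_le_price_singleton_zero [NeZero m] : 1 ≤ (q.ladder m).price {0} 0 := by
  have hout (j : Fin m) (hj : j ∈ ({0} : Finset (Fin m))) : ¬ IsOutranked n {0} j := by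
    simp [IsOutranked, Finset.mem_singleton.1 hj]
  have hhighest : IsHighest n ({0} : Finset (Fin m)) 0 :=
    ⟨Finset.mem_singleton_self 0, Nat.pos_of_neZero n, hout 0 (Finset.mem_singleton_self 0)⟩
  calc 1 ≤ q.top (0 : Fin m) := q.one_le_top _
    _ = q.stablePrice {0} 0 := by
      rw [q.stablePrice_of_isHighest hhighest, q.secondTop_eq_zero hout, sub_zero]
    _ ≤ _ := q.stablePrice_le_price {0} 0

variable {α : ℝ} {x : Fin m → ℝ}

lemma δ_le_of_isMixedEquilibrium (hα : α ≤ 1) (hx : (q.ladder m).IsMixedEquilibrium α x)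
    (hk1 : 1 ≤ (k : ℕ)) (hkn : (k : ℕ) < n) (hk : x k ≠ 0)
    (hmax : ∀ j, x j ≠ 0 → (j : ℕ) < n → j ≤ k) : q.δ k ≤ (1 - α) * n := by
  have hoff : q.δ k ≤ (q.ladder m).offPrice x k := by
    refine le_expect (update_zero_mem_Icc hx.1 k) fun Q hQ =>
      q.δ_le_price hk1 hkn fun j hj hjn => ?_
    have hxj := ne_zero_of_joinProb_ne_zero hQ hj
    have hjk : j ≠ k := by
      rintro rfl
      exact hxj (Function.update_self ..)
    rw [Function.update_of_ne hjk] at hxj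
    exact (hmax j hxj hjn).lt_of_ne hjk
  have hon : (q.ladder m).onPrice x k ≤ n := expect_le (update_zero_mem_Icc hx.1 k) fun Q _ =>
    (q.price_le_top _ k).trans (q.top_le hkn)
  calc q.δ k ≤ (q.ladder m).offPrice x k := hoff
    _ ≤ (1 - α) * (q.ladder m).onPrice x k :=
      hx.offPrice_le_of_pos ((hx.1 k).1.lt_of_ne' hk)
    _ ≤ (1 - α) * n := mul_le_mul_of_nonneg_left hon (sub_nonneg.2 hα)

lemma eq_one_of_isMixedEquilibrium (hα : α ≤ 1) (hx : (q.ladder m).IsMixedEquilibrium α x)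
    (hjn : (j : ℕ) < n) (hδ : q.δ j < (1 - α) * (q.ε / 2)) : x j = 1 := by
  refine hx.eq_one_of_offPrice_lt ?_
  have hoff : (q.ladder m).offPrice x j ≤ q.δ j :=
    expect_le (update_zero_mem_Icc hx.1 j) fun Q hQ =>
      q.price_le_δ (notMem_of_joinProb_update_ne_zero hQ)
  have hon : q.ε / 2 ≤ (q.ladder m).onPrice x j :=
    le_expect (update_zero_mem_Icc hx.1 j) fun Q _ =>
      q.half_ε_le_price (Finset.mem_insert_self j Q) hjn
  exact (hoff.trans_lt hδ).trans_le (mul_le_mul_of_nonneg_left hon (sub_nonneg.2 hα))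

lemma mem_of_lt (hα : α ≤ 1) (hx : (q.ladder m).IsMixedEquilibrium α x)
    (hP : joinProb x P ≠ 0) (hk : k ∈ P) (hkn : (k : ℕ) < n) (hjk : j < k) : j ∈ P := by
  by_contra hj
  obtain ⟨l, hl, hln, hmax⟩ : ∃ l, x l ≠ 0 ∧ (l : ℕ) < n ∧ ∀ i, x i ≠ 0 → (i : ℕ) < n → i ≤ l := by
    have hmem : k ∈ Finset.univ.filter fun i : Fin m => x i ≠ 0 ∧ (i : ℕ) < n := by
      simp [hkn, ne_zero_of_joinProb_ne_zero hP hk]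
    obtain ⟨l, hl, hmax⟩ := Finset.exists_max_image _ id ⟨k, hmem⟩
    simp only [Finset.mem_filter, Finset.mem_univ, true_and, id] at hl hmax
    exact ⟨l, hl.1, hl.2, fun i hi hin => hmax i ⟨hi, hin⟩⟩
  have hjl : j < l := hjk.trans_le (hmax k (ne_zero_of_joinProb_ne_zero hP hk) hkn)
  have hδl : q.δ l ≤ (1 - α) * n :=
    q.δ_le_of_isMixedEquilibrium hα hx (by omega) hln hl hmax
  have hδj : n * q.δ j < n * ((1 - α) * (q.ε / 2)) := by
    linarith [q.two_mul_δ_lt hjl hln, mul_le_mul_of_nonneg_left hδl q.ε_pos.le]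
  exact ne_one_of_joinProb_ne_zero hP hj (q.eq_one_of_isMixedEquilibrium hα hx (by omega)
    (lt_of_mul_lt_mul_left hδj n.cast_nonneg))

lemma price_le_one_sub (hk : IsHighest n P k) (hP : ∀ j < k, j ∈ P) :
    (q.ladder m).price P k ≤ 1 - k * q.ε := by
  rcases Nat.eq_zero_or_pos (k : ℕ) with hk0 | hkpos
  · simpa [hk0, top] using q.price_le_top P k
  · have hpred : (⟨k - 1, by omega⟩ : Fin m) ∈ P := hP _ (Fin.lt_def.2 (by simp; omega))
    have hprice := q.price_le_step_add_ε hpred (Nat.sub_add_cancel hkpos) hk.2.1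
    have hkn : (k : ℝ) + 1 ≤ n := by exact_mod_cast hk.2.1
    unfold step at hprice
    linarith [mul_le_mul_of_nonneg_right hkn q.ε_pos.le]

lemma sum_erase_price_le (hk : IsHighest n P k) :
    ∑ j ∈ P.erase k, (q.ladder m).price P j ≤ k * q.ε := by
  calc ∑ j ∈ P.erase k, (q.ladder m).price P j
      ≤ ∑ j ∈ P.erase k, if j < k then q.ε else 0 := by
        refine Finset.sum_le_sum fun j hj => ?_
        obtain ⟨hjk, hjP⟩ := Finset.mem_erase.1 hj
        split_ifs with hlt
        · exact q.price_le_ε (hk.isOutranked hlt)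
        · exact (q.price_eq_zero_of_le P
            (not_lt.1 fun hjn => hlt ((hk.le hjP hjn).lt_of_ne hjk))).le
    _ ≤ ∑ j, if j < k then q.ε else 0 :=
        Finset.sum_le_univ_sum_of_nonneg fun j => by split_ifs <;> linarith [q.ε_pos]
    _ = k * q.ε := by simp [← Finset.sum_filter, Finset.filter_gt_eq_Iio]

lemma sum_price_le_one (hk : IsHighest n P k) (hP : ∀ j < k, j ∈ P) :
    ∑ j ∈ P, (q.ladder m).price P j ≤ 1 := by
  rw [← Finset.add_sum_erase P _ hk.1]
  linarith [q.price_le_one_sub hk hP, q.sum_erase_price_le hk]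

lemma revenue_le_min (hα : α ∈ Set.Icc (0 : ℝ) 1) (hx : (q.ladder m).IsMixedEquilibrium α x)
    (hP : joinProb x P ≠ 0) :
    (q.ladder m).revenue α P ≤ min 1 ((q.ladder m).welfare ((q.ladder m).linkWith P)) := by
  by_cases hladder : ∃ j ∈ P, (j : ℕ) < n
  · obtain ⟨j, hj, hjn⟩ := hladder
    obtain ⟨k, hk⟩ := exists_isHighest hj hjn
    have hrevenue : (q.ladder m).revenue α P ≤ 1 := mul_le_one₀ hα.2
      (Finset.sum_nonneg fun j _ => price_nonneg _ P j)
      (q.sum_price_le_one hk fun j => q.mem_of_lt hα.2 hx hP hk.1 hk.2.1)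
    refine le_min hrevenue (hrevenue.trans ?_)
    calc 1 ≤ q.top j := q.one_le_top j
      _ = (q.ladder m).value 0 j := (q.value_eq_top rfl hjn).symm
      _ ≤ _ := value_le_welfare (Or.inl hj)
  · have hrevenue : (q.ladder m).revenue α P = 0 := by
      rw [revenue, Finset.sum_eq_zero fun j hj => ?_, mul_zero]
      exact q.price_eq_zero_of_le P (not_lt.1 fun hjn => hladder ⟨j, hj, hjn⟩)
    rw [hrevenue]
    exact le_min zero_le_one (welfare_nonneg _ _)

section

variable [NeZero m]

lemma one_le_revenue_one_singleton_zero : 1 ≤ (q.ladder m).revenue 1 {0} := by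
  simpa [revenue] using q.one_le_price_singleton_zero

lemma isMixedOptimal_one_pureProfile : (q.ladder m).IsMixedOptimal 1 (pureProfile {0}) := by
  refine ⟨by simp, q.isPureEquilibrium_one_singleton_zero.isMixedEquilibrium, fun β hβ y hy => ?_⟩
  rw [expect_pureProfile]
  exact (expect_le hy.1 fun P hP => (q.revenue_le_min hβ hy hP).trans (min_le_left ..)).trans
    q.one_le_revenue_one_singleton_zero

lemma one_le_expect_welfare (h : (q.ladder m).IsMixedOptimal α x) :
    1 ≤ expect x fun P => (q.ladder m).welfare ((q.ladder m).linkWith P) := by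
  calc 1 ≤ (q.ladder m).revenue 1 {0} := q.one_le_revenue_one_singleton_zero
    _ = expect (pureProfile {0}) ((q.ladder m).revenue 1) := (expect_pureProfile ..).symm
    _ ≤ expect x ((q.ladder m).revenue α) := h.2.2 1 (by simp) _
      q.isPureEquilibrium_one_singleton_zero.isMixedEquilibrium
    _ ≤ _ := expect_mono h.2.1.1 fun P hP => (q.revenue_le_min h.1 h.2.1 hP).trans (min_le_right ..)

end

lemma welfare_le_add {g : Fin n → Fin m → Prop} {c : ℝ} (hc : 0 ≤ c)
    (h : ∀ j, g 0 j → (q.ladder m).value 0 j ≤ c) : (q.ladder m).welfare g ≤ c + n * q.ε := by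
  have hε := q.ε_pos
  calc (q.ladder m).welfare g ≤ ∑ i : Fin n, ((if i = 0 then c else 0) + q.ε) := by
        refine welfare_le_sum (fun i => ?_) fun i j hij => ?_
        · split_ifs <;> linarith
        · split_ifs with hi
          · subst hi
            linarith [h j hij]
          · linarith [q.value_le_ε j (fun h0 => hi (Fin.ext h0))]
    _ = c + n * q.ε := by simp [Finset.sum_add_distrib]

lemma optimalWelfare_le : (q.ladder m).optimalWelfare ≤ q.top (min n m - 1) + n * q.ε := by
  have htop := q.one_le_top (min n m - 1)
  refine q.welfare_le_add (by linarith) fun j _ => ?_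
  rcases le_or_gt n (j : ℕ) with hjn | hjn
  · rw [q.value_eq_zero_of_le 0 hjn]
    linarith
  · exact (q.value_le_top 0 j).trans (q.top_mono (by omega))

variable [NeZero m]

lemma welfare_singleton_zero_le :
    (q.ladder m).welfare ((q.ladder m).linkWith {0}) ≤ 1 + n * q.ε := by
  refine q.welfare_le_add zero_le_one fun j hj => ?_
  have hj0 : j = 0 := by simpa [linkWith_iff] using hj
  simpa [hj0, top] using q.value_le_top 0 j

lemma top_le_optimalWelfare : q.top (min n m - 1) ≤ (q.ladder m).optimalWelfare := by
  have hn := Nat.pos_of_neZero n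
  have hm := Nat.pos_of_neZero m
  let j : Fin m := ⟨min n m - 1, by omega⟩
  have hj : (j : ℕ) < n := by simp [j]; omega
  exact (q.value_eq_top (i := 0) rfl hj).symm.trans_le (value_le_welfare trivial)

lemma ofReal_le_purePoA :
    ENNReal.ofReal (q.top (min n m - 1) / (1 + n * q.ε)) ≤ (q.ladder m).purePoA := by
  have hε := q.ε_pos
  have hopt := q.isMixedOptimal_one_pureProfile.isPureOptimal
    (q.isPureEquilibrium_one_singleton_zero (m := m))
  rw [ENNReal.ofReal_div_of_pos (by positivity)]
  exact (ENNReal.div_le_div (ENNReal.ofReal_le_ofReal q.top_le_optimalWelfare)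
    (ENNReal.ofReal_le_ofReal q.welfare_singleton_zero_le)).trans hopt.div_le_purePoA

lemma purePoA_le_mixedPoA : (q.ladder m).purePoA ≤ (q.ladder m).mixedPoA :=
  q.isMixedOptimal_one_pureProfile.purePoA_le_mixedPoA q.isPureEquilibrium_one_singleton_zero

lemma mixedPoA_le_ofReal :
    (q.ladder m).mixedPoA ≤ ENNReal.ofReal (q.top (min n m - 1) + n * q.ε) := by
  refine iSup_le fun α => iSup_le fun x => iSup_le fun h => ?_
  calc _ ≤ ENNReal.ofReal (q.ladder m).optimalWelfare / 1 :=
        ENNReal.div_le_div_left (ENNReal.one_le_ofReal.2 (q.one_le_expect_welfare h)) _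
    _ ≤ _ := by
        rw [div_one]
        exact ENNReal.ofReal_le_ofReal q.optimalWelfare_le

end

section

variable {ι : Type*} {l : Filter ι} {q : ι → LadderScale n}

lemma tendsto_top (hq : Tendsto (fun i => (q i).ε) l (𝓝 0)) (j : ℕ) :
    Tendsto (fun i => (q i).top j) l (𝓝 (j + 1)) := by
  have h := ((hq.const_mul (n : ℝ)).const_sub 1 |>.const_mul (j : ℝ)).const_add 1
  simpa [top, step, add_comm] using h

lemma tendsto_purePoA_and_mixedPoA [NeZero n] [NeZero m]
    (hq : Tendsto (fun i => (q i).ε) l (𝓝 0)) :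
    Tendsto (fun i => ((q i).ladder m).purePoA) l (𝓝 (min n m : ℕ)) ∧
      Tendsto (fun i => ((q i).ladder m).mixedPoA) l (𝓝 (min n m : ℕ)) := by
  have hmin : ((min n m - 1 : ℕ) : ℝ) + 1 = (min n m : ℕ) := by
    have hn := Nat.pos_of_neZero n
    have hm := Nat.pos_of_neZero m
    exact_mod_cast (show min n m - 1 + 1 = min n m by omega)
  have htop := hmin ▸ tendsto_top hq (min n m - 1)
  have hnε : Tendsto (fun i => n * (q i).ε) l (𝓝 0) := by simpa using hq.const_mul (n : ℝ)
  have hlower := ENNReal.tendsto_ofReal (htop.div (hnε.const_add 1) (by simp))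
  have hupper := ENNReal.tendsto_ofReal (htop.add hnε)
  simp only [add_zero, div_one, ENNReal.ofReal_natCast] at hlower hupper
  exact ⟨tendsto_of_tendsto_of_tendsto_of_le_of_le hlower hupper
      (fun i => (q i).ofReal_le_purePoA)
      (fun i => (q i).purePoA_le_mixedPoA.trans (q i).mixedPoA_le_ofReal),
    tendsto_of_tendsto_of_tendsto_of_le_of_le hlower hupper
      (fun i => (q i).ofReal_le_purePoA.trans (q i).purePoA_le_mixedPoA)
      (fun i => (q i).mixedPoA_le_ofReal)⟩

end

/-- A sequence of scales that tends to `0`. -/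
def scaleSeq (n k : ℕ) [NeZero n] : LadderScale n where
  ε := (4 * n : ℝ)⁻¹ / (k + 1)
  ε_pos := by
    have hn : (0 : ℝ) < n := by exact_mod_cast Nat.pos_of_neZero n
    positivity
  four_mul_le_one := by
    have hn : (n : ℝ) ≠ 0 := NeZero.ne _
    rw [← mul_assoc, ← mul_div_assoc, mul_inv_cancel₀ (by simpa using hn)]
    exact div_le_one_of_le₀ (by simp) (by positivity)

lemma tendsto_scaleSeq (n : ℕ) [NeZero n] :
    Tendsto (fun k => (scaleSeq n k).ε) atTop (𝓝 0) :=
  ((tendsto_const_div_atTop_nhds_zero_nat (4 * n : ℝ)⁻¹).comp (tendsto_add_atTop_nat 1)).congr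
    fun k => by simp [scaleSeq]

end LadderScale

end

theorem mainTheorem9 (n m : ℕ) (hn : 1 ≤ n) (hm : 1 ≤ m) :
    ∃ M : ℕ → Market n m,
      Tendsto (fun k => (M k).purePoA) atTop (𝓝 ((min n m : ℕ) : ℝ≥0∞)) ∧
        Tendsto (fun k => (M k).mixedPoA) atTop (𝓝 ((min n m : ℕ) : ℝ≥0∞)) := by
  have : NeZero n := ⟨by omega⟩
  have : NeZero m := ⟨by omega⟩
  exact ⟨fun k => (LadderScale.scaleSeq n k).ladder m,
    LadderScale.tendsto_purePoA_and_mixedPoA (LadderScale.tendsto_scaleSeq n)⟩
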